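/- Let $G=(V,E)$ be a connected finite simple graph with $n=|V|\ge 3$ vertices, and let $|G\rangle=\prod_{\{u,v\}\in E}CZ(u,v)\,H^{\otimes V}|0\rangle^{\otimes V}\in(\mathbb{C}^2)^{\otimes V}$ be its graph state, with density operator $\rho=|G\rangle\langle G|$. For $J\subseteq V$ let $\rho_J=\mathrm{Tr}_{V\setminus J}\,\rho$ be the reduced state on $J$, let $S_2(J)=1-\mathrm{Tr}(\rho_J^2)$ be its Tsallis $2$-entropy, and for distinct $u,v\in V$ let $$C_2(u,v)=S_2(\{u\})+S_2(\{v\})-S_2(\{u,v\})$$ be the $2$-deformed correlation of the pair. Then $\rho$ is locally unitarily equivalent to the $n$-qubit GHZ state, i.e. there are single-qubit unitaries $(U_v)_{v\in V}$ with $$\Big(\bigotimes_{v}U_v\Big)\rho\Big(\bigotimes_{v}U_v\Big)^\dagger=|\mathrm{GHZ}_n\rangle\langle \mathrm{GHZ}_n|,\qquad |\mathrm{GHZ}_n\rangle=\tfrac{1}{\sqrt2}\big(|0\rangle^{\otimes n}+|1\rangle^{\otimes n}\big),$$ if and only if $C_2(u,v)=\tfrac12$ for every pair of distinct vertices $u,v\in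 V$. Moreover, if $C_2(u,v)=\tfrac12$ for every pair of distinct vertices, then $G$ is a star or a complete graph. -/

import Mathlib

namespace QubitState

/-- Operators on the Hilbert space `(ℂ²)^{⊗ V}` of qubits labelled by `V`, as matrices in the
computational basis; the basis vectors are labelled by bit assignments `V → Fin 2`. -/
abbrev Op (V : Type*) := Matrix (V → Fin 2) (V → Fin 2) ℂ

/-- State vectors of qubits labelled by `V`, by their amplitudes in the computational basis. -/
abbrev Ket (V : Type*) := (V → Fin 2) → ℂ

section
variable {V : Type*} [Fintype V]

/-- The tensor product `⨂ v, U v` of single-qubit operators. -/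
def localOp (U : V → Matrix (Fin 2) (Fin 2) ℂ) : Op V :=
  Matrix.of fun x y => ∏ v, U v (x v) (y v)

/-- The computational basis vector `|x⟩`. -/
def basisKet (x : V → Fin 2) : Ket V := Pi.single x 1

/-- The Hadamard gate. -/
noncomputable def hadamard : Matrix (Fin 2) (Fin 2) ℂ :=
  ((1 / Real.sqrt 2 : ℝ) : ℂ) • !![1, 1; 1, -1]

/-- The controlled-`Z` gate acting between the qubits `u` and `v`. -/
def czGate (u v : V) : Op V :=
  Matrix.diagonal fun x => if x u = 1 ∧ x v = 1 then -1 else 1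

theorem czGate_comm (u v : V) : czGate u v = czGate v u := by
  simp only [czGate, and_comm]

/-- The controlled-`Z` gate attached to an (unordered) edge. -/
def czEdge (e : Sym2 V) : Op V := Sym2.lift ⟨czGate, czGate_comm⟩ e

variable [DecidableEq V]

theorem czEdge_commute (e f : Sym2 V) : Commute (czEdge e) (czEdge f) := by
  induction e using Sym2.ind with
  | _ a b =>
    induction f using Sym2.ind with
    | _ c d => exact Matrix.commute_diagonal _ _

/-- The graph state `|G⟩ = ∏_{uv ∈ E} CZ(u, v) H^{⊗ V} |0⟩^{⊗ V}`. -/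
noncomputable def graphKet (G : SimpleGraph V) [DecidableRel G.Adj] : Ket V :=
  (G.edgeFinset.noncommProd czEdge (fun e _ f _ _ => czEdge_commute e f) *
    localOp (fun _ => hadamard)).mulVec (basisKet fun _ => 0)

/-- The GHZ state `(|0⟩^{⊗ V} + |1⟩^{⊗ V}) / √2`. -/
noncomputable def ghzKet (V : Type*) [Fintype V] : Ket V :=
  ((1 / Real.sqrt 2 : ℝ) : ℂ) • (basisKet (fun _ => 0) + basisKet (fun _ => 1))

/-- The density operator `|ψ⟩⟨ψ|` of a pure state. -/
def density (ψ : Ket V) : Op V := Matrix.vecMulVec ψ (star ψ)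

/-- Two states are equivalent under local unitaries if `(⨂ U_v) ρ (⨂ U_v)† = σ` for some
single-qubit unitaries `U_v`. -/
def LUEquiv (ρ σ : Op V) : Prop :=
  ∃ U : V → Matrix.unitaryGroup (Fin 2) ℂ,
    localOp (fun v => (U v : Matrix (Fin 2) (Fin 2) ℂ)) * ρ *
      (localOp (fun v => (U v : Matrix (Fin 2) (Fin 2) ℂ))).conjTranspose = σ

/-- The bit assignment on `V` that is `a` on `J` and `c` on the complement of `J`. -/
def glue (J : Finset V) (a : {v // v ∈ J} → Fin 2) (c : {v // v ∉ J} → Fin 2) : V → Fin 2 :=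
  fun v => if h : v ∈ J then a ⟨v, h⟩ else c ⟨v, h⟩

/-- The reduced state `ρ_J`: the partial trace of `ρ` over the qubits outside `J`. -/
def reduced (ρ : Op V) (J : Finset V) : Op {v // v ∈ J} :=
  Matrix.of fun a b => ∑ c : {v // v ∉ J} → Fin 2, ρ (glue J a c) (glue J b c)

/-- The Tsallis `2`-entropy (linear entropy) `S₂(J) = 1 - Tr (ρ_J²)`; for Hermitian `ρ` the trace
is real. -/
def entropy₂ (ρ : Op V) (J : Finset V) : ℝ := 1 - (Matrix.trace (reduced ρ J ^ 2)).re

/-- The `2`-deformed correlation `C₂(J, K) = S₂(J) + S₂(K) - S₂(J ∪ K)` of disjoint `J`, `K`. -/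
def corr₂ (ρ : Op V) (J K : Finset V) : ℝ :=
  entropy₂ ρ J + entropy₂ ρ K - entropy₂ ρ (J ∪ K)

end

end QubitState

/-!
The amplitude of `|x⟩` in the graph state is `2^(-n/2)` times the sign `graphSign G x`, and flipping
the bit of a vertex `w` multiplies that sign by `(-1)^(x v)` for every neighbour `v` of `w`
(`graphSign_flip`).

For an entry `(a, b)` of a reduced state, flipping the bit of a vertex outside `J` that has an odd
number of neighbours in the set where `a` and `b` differ reverses the sign of each summand, so the
entry vanishes. If the cut matrix between `J` and its complement has full rank over `𝔽₂`, this kills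
all off-diagonal entries and the reduced state is maximally mixed
(`entropy₂_graphKet_of_full_rank`). In a connected graph every vertex therefore has entropy `1/2`,
and a pair whose cut matrix has rank two has entropy `3/4`, hence correlation `1/4`. So correlation
`1/2` forces rank at most one: one of the two vertices has no further neighbour, or both have the
same further neighbours (`neighbors_of_corr₂_eq_half`). If this holds for all pairs and `u`, `v` are
not adjacent, then they have a common neighbour `r`, which is the only neighbour of `u` and hence of
every other vertex, so `G` is a star (`starGraph_or_top_of_corr₂`).

Conversely, the star state is `(|0⟩|+…+⟩ + |1⟩|-…-⟩) / √2`, and the complete graph state, with signs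
`(-1)^(k(k-1)/2)` at weight `k`, is `(e^(-iπ/4) |+i⟩^{⊗n} + e^(iπ/4) |-i⟩^{⊗n}) / √2`; both are
images of the GHZ state under explicit local unitaries (`luEquiv_of_eq_starGraph`,
`luEquiv_of_eq_top`). Finally, local unitaries preserve all entropies (`LUEquiv.entropy₂_eq`), and
every nonempty proper subset has entropy `1/2` in the GHZ state (`entropy₂_ghzKet`), which gives the
correlation `1/2` for every pair as soon as there is a third vertex.
-/

namespace QubitState

section

/-! ### Amplitudes of graph states -/

/-- The sign `(-1)^b` of a bit `b`. -/
def bitSign (b : Fin 2) : ℤ := if b = 1 then -1 else 1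

theorem bitSign_mul_self (b : Fin 2) : bitSign b * bitSign b = 1 := by
  unfold bitSign; split_ifs <;> simp

theorem bitSign_mul_bitSign (a b : Fin 2) :
    bitSign a * bitSign b = if a = b then 1 else -1 := by
  fin_cases a <;> fin_cases b <;> simp [bitSign]

theorem invSqrtTwo_mul_self :
    ((1 / Real.sqrt 2 : ℝ) : ℂ) * ((1 / Real.sqrt 2 : ℝ) : ℂ) = 1 / 2 := by
  rw [← Complex.ofReal_mul, div_mul_div_comm, Real.mul_self_sqrt (by norm_num)]
  norm_num

theorem hadamard_apply_zero (b : Fin 2) : hadamard b 0 = ((1 / Real.sqrt 2 : ℝ) : ℂ) := by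
  fin_cases b <;> simp [hadamard]

variable {V : Type*} [Fintype V] [DecidableEq V]

/-- The diagonal entry of `CZ` on the edge `e` at the bit assignment `x`. -/
def edgeSign (e : Sym2 V) (x : V → Fin 2) : ℤ := if ∀ v ∈ e, x v = 1 then -1 else 1

theorem edgeSign_mk (u v : V) (x : V → Fin 2) :
    edgeSign s(u, v) x = if x u = 1 ∧ x v = 1 then -1 else 1 := by
  simp [edgeSign]

theorem edgeSign_mul_self (e : Sym2 V) (x : V → Fin 2) : edgeSign e x * edgeSign e x = 1 := by
  unfold edgeSign; split_ifs <;> simp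

theorem czEdge_eq_diagonal (e : Sym2 V) :
    czEdge e = Matrix.diagonal fun x => (edgeSign e x : ℂ) := by
  induction e using Sym2.ind with
  | _ u v =>
    simp only [czEdge, Sym2.lift_mk, czGate, edgeSign_mk]
    congr 1; ext x; split_ifs <;> simp

theorem noncommProd_czEdge (s : Finset (Sym2 V))
    (h : (s : Set (Sym2 V)).Pairwise (Function.onFun Commute czEdge)) :
    s.noncommProd czEdge h =
      Matrix.diagonal fun x => ((∏ e ∈ s, edgeSign e x : ℤ) : ℂ) := by
  induction s using Finset.induction_on with
  | empty => simp
  | insert e s he ih =>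
    rw [Finset.noncommProd_insert_of_notMem _ _ _ _ he, ih, czEdge_eq_diagonal,
      Matrix.diagonal_mul_diagonal]
    congr 1; ext x; rw [Finset.prod_insert he]; push_cast; rfl

/-- The sign of the amplitude of `|x⟩` in the graph state of `G`: the parity of the number of
edges both of whose ends carry the bit `1`. -/
def graphSign (G : SimpleGraph V) [DecidableRel G.Adj] (x : V → Fin 2) : ℤ :=
  ∏ e ∈ G.edgeFinset, edgeSign e x

theorem graphKet_apply (G : SimpleGraph V) [DecidableRel G.Adj] (x : V → Fin 2) :
    graphKet G x = ((1 / Real.sqrt 2 : ℝ) : ℂ) ^ Fintype.card V * (graphSign G x : ℂ) := by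
  have hcz : G.edgeFinset.noncommProd czEdge (fun e _ f _ _ => czEdge_commute e f) =
      Matrix.diagonal fun x => (graphSign G x : ℂ) := noncommProd_czEdge _ _
  unfold graphKet
  rw [hcz, ← Matrix.mulVec_mulVec, Matrix.mulVec_diagonal, basisKet,
    Matrix.mulVec_single_one, mul_comm]
  simp only [Matrix.col_apply, localOp, Matrix.of_apply, hadamard_apply_zero,
    Finset.prod_const, Finset.card_univ]

variable (G : SimpleGraph V) [DecidableRel G.Adj]

theorem graphSign_mul_self (x : V → Fin 2) : graphSign G x * graphSign G x = 1 := by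
  rw [graphSign, ← Finset.prod_mul_distrib]
  exact Finset.prod_eq_one fun e _ => edgeSign_mul_self e x

theorem graphSign_zero : graphSign G (fun _ => 0) = 1 := by
  refine Finset.prod_eq_one fun e _ => ?_
  induction e using Sym2.ind with
  | _ u v => simp [edgeSign_mk]

/-- The edges at `w` contribute to the sign of `x` only if `x w = 1`, and then one factor
`(-1)^(x v)` for each neighbour `v`. -/
theorem graphSign_eq_mul (w : V) (x : V → Fin 2) :
    graphSign G x = (∏ e ∈ G.edgeFinset with w ∉ e, edgeSign e x) *
      if x w = 1 then ∏ v ∈ G.neighborFinset w, bitSign (x v) else 1 := by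
  rw [graphSign, ← Finset.prod_filter_not_mul_prod_filter _ (fun e => w ∈ e)]
  congr 1
  have himg : (G.edgeFinset.filter fun e => w ∈ e) =
      (G.neighborFinset w).image fun v => s(w, v) := by
    ext e
    induction e using Sym2.ind with
    | _ a b =>
      simp only [Finset.mem_filter, SimpleGraph.mem_edgeFinset, SimpleGraph.mem_edgeSet,
        Sym2.mem_iff, Finset.mem_image, SimpleGraph.mem_neighborFinset]
      constructor
      · rintro ⟨h, rfl | rfl⟩
        · exact ⟨b, h, rfl⟩
        · exact ⟨a, h.symm, Sym2.eq_swap⟩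
      · rintro ⟨v, h, hv⟩
        rcases Sym2.eq_iff.1 hv with ⟨rfl, rfl⟩ | ⟨rfl, rfl⟩
        · exact ⟨h, Or.inl rfl⟩
        · exact ⟨h.symm, Or.inr rfl⟩
  rw [himg, Finset.prod_image (fun a _ b _ h => Sym2.congr_right.1 h)]
  split_ifs with hw <;> simp [edgeSign_mk, hw, bitSign]

/-- Setting the bit of `w` multiplies the sign by `(-1)^(x v)` for each neighbour `v` of `w`. -/
theorem graphSign_update_one (w : V) (x : V → Fin 2) :
    graphSign G (Function.update x w 1) = graphSign G (Function.update x w 0) *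
      ∏ v ∈ G.neighborFinset w, bitSign (x v) := by
  have hoff : ∀ b, (∏ e ∈ G.edgeFinset with w ∉ e, edgeSign e (Function.update x w b)) =
      ∏ e ∈ G.edgeFinset with w ∉ e, edgeSign e x := by
    intro b
    refine Finset.prod_congr rfl fun e he => ?_
    have hw := (Finset.mem_filter.1 he).2
    unfold edgeSign
    congr 1
    refine propext (forall₂_congr fun v hv => ?_)
    rw [Function.update_of_ne (by rintro rfl; exact hw hv)]
  have hnb : ∀ b, (∏ v ∈ G.neighborFinset w, bitSign (Function.update x w b v)) =
      ∏ v ∈ G.neighborFinset w, bitSign (x v) := by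
    intro b
    refine Finset.prod_congr rfl fun v hv => ?_
    rw [Function.update_of_ne]
    rintro rfl
    simp at hv
  rw [graphSign_eq_mul G w, graphSign_eq_mul G w (Function.update x w 0), hoff, hoff, hnb]
  simp

theorem graphSign_flip (w : V) (x : V → Fin 2) :
    graphSign G (Function.update x w (x w + 1)) = graphSign G x *
      ∏ v ∈ G.neighborFinset w, bitSign (x v) := by
  have h := graphSign_update_one G w x
  have hsq : (∏ v ∈ G.neighborFinset w, bitSign (x v)) *
      ∏ v ∈ G.neighborFinset w, bitSign (x v) = 1 := by
    rw [← Finset.prod_mul_distrib]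
    exact Finset.prod_eq_one fun v _ => bitSign_mul_self _
  obtain hx | hx : x w = 0 ∨ x w = 1 := by
    generalize x w = b; fin_cases b <;> simp
  · have : Function.update x w 0 = x := by rw [← hx]; exact Function.update_eq_self w x
    rw [hx, zero_add, h, this]
  · have : Function.update x w 1 = x := by rw [← hx]; exact Function.update_eq_self w x
    rw [this] at h
    rw [hx, h, mul_assoc, hsq, mul_one]
    rfl

/-- A function on bit assignments that is `1` at zero and obeys the recursion of
`graphSign_update_one` is the sign function of the graph. -/
theorem eq_graphSign (F : (V → Fin 2) → ℂ) (h0 : F (fun _ => 0) = 1)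
    (h : ∀ w x, x w = 0 → F (Function.update x w 1) = F x *
      ((∏ v ∈ G.neighborFinset w, bitSign (x v) : ℤ) : ℂ)) (x : V → Fin 2) :
    F x = (graphSign G x : ℂ) := by
  -- Induction on the set of vertices carrying the bit `1`.
  have key : ∀ s : Finset V, F (fun v => if v ∈ s then 1 else 0) =
      (graphSign G (fun v => if v ∈ s then 1 else 0) : ℂ) := by
    intro s
    induction s using Finset.induction_on with
    | empty => simp [h0, graphSign_zero]
    | insert w s hw ih =>
      set y : V → Fin 2 := fun v => if v ∈ s then 1 else 0 with hy
      have hyw : y w = 0 := by simp [hy, hw]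
      have hins : (fun v => if v ∈ insert w s then (1 : Fin 2) else 0) =
          Function.update y w 1 := by
        ext v
        by_cases hv : v = w
        · subst hv; simp
        · simp [hv, hy]
      have hy0 : Function.update y w 0 = y := by
        rw [← hyw]; exact Function.update_eq_self w y
      rw [hins, h w y hyw, graphSign_update_one, hy0, ih]
      push_cast; rfl
  have hx : (fun v => if v ∈ Finset.univ.filter (fun v => x v = 1) then (1 : Fin 2) else 0) =
      x := by
    funext v
    simp only [Finset.mem_filter_univ]
    generalize x v = b
    fin_cases b <;> simp
  have h1 := key (Finset.univ.filter fun v => x v = 1)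
  rwa [hx] at h1

end

section
variable {V : Type*} [DecidableEq V]

/-! ### Entropies of graph states -/

theorem glue_apply_mem (J : Finset V) (a : {v // v ∈ J} → Fin 2) (c : {v // v ∉ J} → Fin 2)
    {v : V} (h : v ∈ J) : glue J a c v = a ⟨v, h⟩ := dif_pos h

theorem glue_apply_notMem (J : Finset V) (a : {v // v ∈ J} → Fin 2) (c : {v // v ∉ J} → Fin 2)
    {v : V} (h : v ∉ J) : glue J a c v = c ⟨v, h⟩ := dif_neg h

theorem glue_update (J : Finset V) (a : {v // v ∈ J} → Fin 2) (c : {v // v ∉ J} → Fin 2)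
    (w : {v // v ∉ J}) (b : Fin 2) :
    glue J a (Function.update c w b) = Function.update (glue J a c) w b := by
  ext v
  by_cases hv : v ∈ J
  · have : v ≠ w := by rintro rfl; exact w.2 hv
    rw [glue_apply_mem J _ _ hv, Function.update_of_ne this, glue_apply_mem J _ _ hv]
  · rw [glue_apply_notMem J _ _ hv]
    by_cases hw : v = w
    · obtain ⟨w, hw'⟩ := w
      subst hw; simp
    · rw [Function.update_of_ne hw, Function.update_of_ne (by rintro rfl; exact hw rfl),
        glue_apply_notMem J _ _ hv]

theorem glue_eq_const_iff (J : Finset V) (a : {v // v ∈ J} → Fin 2)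
    (c : {v // v ∉ J} → Fin 2) (b : Fin 2) :
    (glue J a c = fun _ => b) ↔ (a = fun _ => b) ∧ c = fun _ => b := by
  constructor
  · intro h
    refine ⟨funext fun v => ?_, funext fun v => ?_⟩
    · rw [← congrFun h v, glue_apply_mem J _ _ v.2]
    · rw [← congrFun h v, glue_apply_notMem J _ _ v.2]
  · rintro ⟨rfl, rfl⟩
    funext v
    simp [glue]

variable [Fintype V] (G : SimpleGraph V) [DecidableRel G.Adj]

/-- If some vertex outside `J` has an odd number of neighbours in the set where `a` and `b`
differ, flipping its bit changes the sign of every summand, so the sum vanishes. -/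
theorem sum_graphSign_glue_eq_zero (J : Finset V) (a b : {v // v ∈ J} → Fin 2)
    {w : V} (hw : w ∉ J)
    (hodd : Odd (G.neighborFinset w ∩
      J.filter fun v => glue J a (fun _ => 0) v ≠ glue J b (fun _ => 0) v).card) :
    ∑ c : {v // v ∉ J} → Fin 2, graphSign G (glue J a c) * graphSign G (glue J b c) = 0 := by
  refine Finset.sum_involution (fun c _ => Function.update c ⟨w, hw⟩ (c ⟨w, hw⟩ + 1))
    (fun c _ => ?_) (fun c _ _ h => ?_) (fun c _ => Finset.mem_univ _) (fun c _ => ?_)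
  · have h1 : ∀ a, graphSign G (glue J a (Function.update c ⟨w, hw⟩ (c ⟨w, hw⟩ + 1))) =
        graphSign G (glue J a c) * ∏ v ∈ G.neighborFinset w, bitSign (glue J a c v) := by
      intro a
      rw [glue_update, ← graphSign_flip, glue_apply_notMem J _ _ hw]
    have h2 : (∏ v ∈ G.neighborFinset w, bitSign (glue J a c v)) *
        ∏ v ∈ G.neighborFinset w, bitSign (glue J b c v) = -1 := by
      rw [← Finset.prod_mul_distrib]
      simp only [bitSign_mul_bitSign]
      rw [Finset.prod_ite]
      simp only [Finset.prod_const_one, one_mul, Finset.prod_const]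
      convert hodd.neg_one_pow using 3
      ext v
      simp only [Finset.mem_filter, Finset.mem_inter]
      by_cases hv : v ∈ J
      · simp [glue_apply_mem J _ _ hv, hv]
      · simp [glue_apply_notMem J _ _ hv, hv]
    rw [h1, h1]
    linear_combination graphSign G (glue J a c) * graphSign G (glue J b c) * h2
  · have := congrFun h ⟨w, hw⟩
    simp at this
  · ext v
    by_cases hv : v = ⟨w, hw⟩
    · subst hv
      simp only [Function.update_self]
      generalize c _ = t
      fin_cases t <;> rfl
    · simp [Function.update_of_ne hv]

theorem reduced_density_graphKet (J : Finset V) (a b : {v // v ∈ J} → Fin 2) :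
    reduced (density (graphKet G)) J a b = (1 / 2 : ℂ) ^ Fintype.card V *
      ((∑ c : {v // v ∉ J} → Fin 2,
        graphSign G (glue J a c) * graphSign G (glue J b c) : ℤ) : ℂ) := by
  simp only [reduced, density, Matrix.of_apply, Matrix.vecMulVec_apply, Pi.star_apply,
    graphKet_apply]
  rw [← invSqrtTwo_mul_self, mul_pow, Int.cast_sum, Finset.mul_sum]
  refine Finset.sum_congr rfl fun c _ => ?_
  simp only [star_mul', star_pow, Complex.star_def, Complex.conj_ofReal, map_intCast]
  push_cast; ring

/-- If every nonempty `D ⊆ J` is seen an odd number of times by some vertex outside `J` (the cut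
matrix of `J` has full rank over `𝔽₂`), then the reduced state on `J` is maximally mixed. -/
theorem entropy₂_graphKet_of_full_rank (J : Finset V)
    (h : ∀ D ⊆ J, D.Nonempty → ∃ w ∉ J, Odd (G.neighborFinset w ∩ D).card) :
    entropy₂ (density (graphKet G)) J = 1 - (1 / 2) ^ J.card := by
  have hred : reduced (density (graphKet G)) J =
      ((1 / 2 : ℂ) ^ J.card) • (1 : Op {v // v ∈ J}) := by
    ext a b
    rw [reduced_density_graphKet, Matrix.smul_apply, Matrix.one_apply]
    split_ifs with hab
    · subst hab
      have hc : Fintype.card V = J.card + Fintype.card {v // v ∉ J} := by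
        rw [Fintype.card_subtype_compl, Fintype.card_coe]
        have := Finset.card_le_univ J
        omega
      simp only [graphSign_mul_self, Finset.sum_const, Finset.card_univ, Fintype.card_fun,
        Fintype.card_fin]
      rw [hc, pow_add]
      simp
    · set D := J.filter fun v => glue J a (fun _ => 0) v ≠ glue J b (fun _ => 0) v with hD
      have hne : D.Nonempty := by
        obtain ⟨v, hv⟩ := Function.ne_iff.1 hab
        exact ⟨v, by simpa [hD, glue_apply_mem] using hv⟩
      obtain ⟨w, hw, hodd⟩ := h D (Finset.filter_subset _ _) hne
      rw [sum_graphSign_glue_eq_zero G J a b hw hodd]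
      simp
  have htr : Matrix.trace (reduced (density (graphKet G)) J ^ 2) =
      (((1 / 2 : ℝ) ^ J.card : ℝ) : ℂ) := by
    rw [hred, smul_pow, one_pow, Matrix.trace_smul, Matrix.trace_one]
    rw [Fintype.card_fun, Fintype.card_fin, Fintype.card_coe, smul_eq_mul]
    push_cast
    rw [pow_two, mul_assoc, ← mul_pow]
    norm_num
  rw [entropy₂, htr, Complex.ofReal_re]

theorem entropy₂_graphKet_singleton {u w : V} (h : G.Adj u w) :
    entropy₂ (density (graphKet G)) {u} = 1 / 2 := by
  rw [entropy₂_graphKet_of_full_rank]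
  · norm_num
  · intro D hD hne
    obtain rfl : D = {u} := (Finset.Nonempty.subset_singleton_iff hne).1 hD
    refine ⟨w, by simpa using h.ne', ?_⟩
    rw [Finset.inter_singleton_of_mem (by simpa using h.symm)]
    simp

/-! ### From correlations to the shape of the graph -/

/-- A pair of correlation `1/2` consists of twins, or one of the two has no further neighbour. -/
theorem neighbors_of_corr₂_eq_half {u v : V} (huv : u ≠ v) (hu : ∃ w, G.Adj u w)
    (hv : ∃ w, G.Adj v w) (h : corr₂ (density (graphKet G)) {u} {v} = 1 / 2) :
    (∀ w, G.Adj u w → w = v) ∨ (∀ w, G.Adj v w → w = u) ∨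
      ∀ w, w ≠ u → w ≠ v → (G.Adj u w ↔ G.Adj v w) := by
  obtain ⟨wu, hwu⟩ := hu
  obtain ⟨wv, hwv⟩ := hv
  by_contra! hcon
  obtain ⟨⟨p, hp, hpv⟩, ⟨q, hq, hqu⟩, r, hru, hrv, hr⟩ := hcon
  have hS := entropy₂_graphKet_of_full_rank G {u, v} (by
    intro D hD hne
    by_cases h1 : u ∈ D <;> by_cases h2 : v ∈ D
    · obtain rfl : D = {u, v} := by
        refine Finset.Subset.antisymm hD ?_
        simp [Finset.insert_subset_iff, h1, h2]
      refine ⟨r, by simp [hru, hrv], ?_⟩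
      by_cases ha : G.Adj u r
      · have hb : ¬ G.Adj v r := by tauto
        rw [Finset.inter_insert_of_mem (by simpa using ha.symm),
          Finset.inter_singleton_of_notMem (by simpa [G.adj_comm] using hb)]
        simp
      · have hb : G.Adj v r := by tauto
        rw [Finset.inter_insert_of_notMem (by simpa [G.adj_comm] using ha),
          Finset.inter_singleton_of_mem (by simpa using hb.symm)]
        simp
    · obtain rfl : D = {u} := by
        ext x; have := @hD x; simp at this ⊢; grind
      refine ⟨p, by simp [hpv, hp.ne'], ?_⟩
      rw [Finset.inter_singleton_of_mem (by simpa using hp.symm)]; simp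
    · obtain rfl : D = {v} := by
        ext x; have := @hD x; simp at this ⊢; grind
      refine ⟨q, by simp [hqu, hq.ne'], ?_⟩
      rw [Finset.inter_singleton_of_mem (by simpa using hq.symm)]; simp
    · obtain ⟨x, hx⟩ := hne
      have := hD hx
      simp at this; grind)
  rw [corr₂, entropy₂_graphKet_singleton G hwu, entropy₂_graphKet_singleton G hwv,
    ← Finset.insert_eq, hS, Finset.card_pair huv] at h
  norm_num at h

theorem starGraph_or_top_of_corr₂ [Nontrivial V] (hG : G.Connected)
    (h : ∀ u v : V, u ≠ v → corr₂ (density (graphKet G)) {u} {v} = 1 / 2) :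
    (∃ r : V, G = SimpleGraph.starGraph r) ∨ G = ⊤ := by
  have hex : ∀ u, ∃ w, G.Adj u w := fun u => hG.preconnected.exists_adj_of_nontrivial u
  have key := fun u v huv => neighbors_of_corr₂_eq_half G huv (hex u) (hex v) (h u v huv)
  by_cases htop : G = ⊤
  · exact Or.inr htop
  left
  obtain ⟨u, v, huv, hadj⟩ : ∃ u v, u ≠ v ∧ ¬ G.Adj u v := by
    by_contra! hc
    refine htop ?_
    ext a b
    exact ⟨fun hab => hab.ne, fun hab => hc a b hab⟩
  -- Nonadjacent vertices have the same neighbours, as neither is isolated.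
  have twins : ∀ a b, a ≠ b → ¬ G.Adj a b → ∀ w, G.Adj a w ↔ G.Adj b w := by
    intro a b hab hn w
    have hn' : ¬ G.Adj b a := fun h => hn h.symm
    obtain ⟨x, hx⟩ := hex a
    obtain ⟨y, hy⟩ := hex b
    rcases key a b hab with h1 | h1 | h1
    · exact absurd (h1 x hx ▸ hx) hn
    · exact absurd (h1 y hy ▸ hy) hn'
    · by_cases hwa : w = a
      · subst hwa; simp [hn']
      · by_cases hwb : w = b
        · subst hwb; simp [hn]
        · exact h1 w hwa hwb
  obtain ⟨r, hr⟩ := hex u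
  have hvr : G.Adj v r := (twins u v huv hadj r).1 hr
  -- `r` sees `v` and `u` does not, so `u` and `r` are not twins: `u` is a leaf at `r`.
  have hur : ∀ w, G.Adj u w → w = r := by
    rcases key u r hr.ne with h1 | h1 | h1
    · exact h1
    · exact absurd (h1 v hvr.symm) huv.symm
    · exact absurd ((h1 v huv.symm hvr.ne).2 hvr.symm) hadj
  refine ⟨r, ?_⟩
  have hnb : ∀ x, x ≠ r → ∀ w, G.Adj x w ↔ w = r := by
    intro x hx w
    have hux : G.Adj u w ↔ w = r := ⟨hur w, fun e => e ▸ hr⟩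
    by_cases hxu : x = u
    · rw [hxu]; exact hux
    · rw [← hux]
      exact twins x u hxu (fun e => hx (hur x e.symm)) w
  ext a b
  rw [SimpleGraph.starGraph_adj]
  by_cases ha : a = r
  · subst ha
    by_cases hb : b = a
    · subst hb; simp
    · rw [G.adj_comm, hnb b hb a]; simp [Ne.symm hb]
  · rw [hnb a ha b]; grind

end

section
variable {V : Type*} [Fintype V]

/-! ### Local unitaries and entropies -/

theorem localOp_conjTranspose (A : V → Matrix (Fin 2) (Fin 2) ℂ) :
    (localOp A).conjTranspose = localOp fun v => (A v).conjTranspose := by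
  ext x y
  simp [localOp, Matrix.conjTranspose_apply]

theorem localOp_one : localOp (fun _ : V => (1 : Matrix (Fin 2) (Fin 2) ℂ)) = 1 := by
  ext x y
  simp only [localOp, Matrix.of_apply, Matrix.one_apply, Finset.prod_ite_zero, funext_iff]
  simp

variable [DecidableEq V]

theorem localOp_mul (A B : V → Matrix (Fin 2) (Fin 2) ℂ) :
    localOp A * localOp B = localOp fun v => A v * B v := by
  ext x z
  simp only [localOp, Matrix.mul_apply, Matrix.of_apply, ← Finset.prod_mul_distrib]
  rw [Finset.prod_univ_sum, Fintype.piFinset_univ]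

theorem localOp_conjTranspose_mul_self (U : V → Matrix.unitaryGroup (Fin 2) ℂ) :
    (localOp fun v => (U v : Matrix (Fin 2) (Fin 2) ℂ)).conjTranspose *
      localOp (fun v => (U v : Matrix (Fin 2) (Fin 2) ℂ)) = 1 := by
  rw [localOp_conjTranspose, localOp_mul, ← localOp_one]
  congr 1
  funext v
  exact Matrix.mem_unitaryGroup_iff'.1 (U v).2

theorem density_mulVec (M : Op V) (ψ : Ket V) :
    density (M.mulVec ψ) = M * density ψ * M.conjTranspose := by
  rw [density, density, Matrix.mul_vecMulVec, Matrix.vecMulVec_mul, Matrix.star_mulVec]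

/-- The image of a state under local unitaries is equivalent to it. -/
theorem luEquiv_density_mulVec (W : V → Matrix.unitaryGroup (Fin 2) ℂ) (ψ : Ket V) :
    LUEquiv (density ((localOp fun v => (W v : Matrix (Fin 2) (Fin 2) ℂ)).mulVec ψ))
      (density ψ) := by
  refine ⟨fun v => (W v)⁻¹, ?_⟩
  have h : (localOp fun v => (((W v)⁻¹ : Matrix.unitaryGroup (Fin 2) ℂ) :
      Matrix (Fin 2) (Fin 2) ℂ)) =
      (localOp fun v => (W v : Matrix (Fin 2) (Fin 2) ℂ)).conjTranspose := by
    rw [localOp_conjTranspose]; rfl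
  rw [h, ← density_mulVec, Matrix.mulVec_mulVec, localOp_conjTranspose_mul_self,
    Matrix.one_mulVec]

theorem sum_eq_sum_glue (J : Finset V) (F : (V → Fin 2) → ℂ) :
    ∑ x, F x = ∑ a : {v // v ∈ J} → Fin 2, ∑ c : {v // v ∉ J} → Fin 2, F (glue J a c) := by
  rw [← Fintype.sum_prod_type' (f := fun a c => F (glue J a c))]
  exact ((Equiv.piEquivPiSubtypeProd (· ∈ J) fun _ => Fin 2).symm.sum_comp F).symm

theorem localOp_glue (U : V → Matrix (Fin 2) (Fin 2) ℂ) (J : Finset V)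
    (a b : {v // v ∈ J} → Fin 2) (c d : {v // v ∉ J} → Fin 2) :
    localOp U (glue J a c) (glue J b d) =
      localOp (fun v : {v // v ∈ J} => U v) a b * localOp (fun v : {v // v ∉ J} => U v) c d := by
  simp only [localOp, Matrix.of_apply]
  refine (Fintype.prod_subtype_mul_prod_subtype (· ∈ J)
    fun v => U v (glue J a c v) (glue J b d v)).symm.trans ?_
  congr 1
  · refine Finset.prod_congr (by ext; simp) fun v _ => ?_
    rw [glue_apply_mem J _ _ v.2, glue_apply_mem J _ _ v.2]
  · refine Finset.prod_congr rfl fun v _ => ?_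
    rw [glue_apply_notMem J _ _ v.2, glue_apply_notMem J _ _ v.2]

/-- The unitaries outside `J` cancel in the partial trace. -/
theorem reduced_localOp_conj (U : V → Matrix.unitaryGroup (Fin 2) ℂ) (ρ : Op V) (J : Finset V) :
    reduced (localOp (fun v => (U v : Matrix (Fin 2) (Fin 2) ℂ)) * ρ *
        (localOp fun v => (U v : Matrix (Fin 2) (Fin 2) ℂ)).conjTranspose) J =
      localOp (fun v : {v // v ∈ J} => (U v : Matrix (Fin 2) (Fin 2) ℂ)) * reduced ρ J *
        (localOp fun v : {v // v ∈ J} => (U v : Matrix (Fin 2) (Fin 2) ℂ)).conjTranspose := by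
  have hQ := localOp_conjTranspose_mul_self fun v : {v // v ∉ J} => U v
  ext a b
  simp only [reduced, Matrix.of_apply, Matrix.mul_apply, Matrix.conjTranspose_apply,
    sum_eq_sum_glue J, localOp_glue]
  set P := localOp fun v : {v // v ∈ J} => (U v : Matrix (Fin 2) (Fin 2) ℂ)
  set Q := localOp fun v : {v // v ∉ J} => (U v : Matrix (Fin 2) (Fin 2) ℂ)
  have hQ' : ∀ d d', ∑ c, star (Q c d) * Q c d' = if d = d' then 1 else 0 := by
    intro d d'
    have := congrFun (congrFun hQ d) d'
    rwa [Matrix.mul_apply, Matrix.one_apply] at this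
  rw [Finset.sum_comm]
  refine Finset.sum_congr rfl fun b' _ => ?_
  calc
    _ = ∑ d, ∑ a', ∑ d', P a a' * ρ (glue J a' d') (glue J b' d) * star (P b b') *
          ∑ c, star (Q c d) * Q c d' := by
      rw [Finset.sum_comm]
      refine Finset.sum_congr rfl fun d _ => ?_
      simp only [Finset.sum_mul, Finset.mul_sum]
      rw [Finset.sum_comm]
      refine Finset.sum_congr rfl fun a' _ => ?_
      rw [Finset.sum_comm]
      refine Finset.sum_congr rfl fun d' _ => Finset.sum_congr rfl fun c _ => ?_
      rw [star_mul']
      ring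
    _ = _ := by
      simp only [hQ', mul_ite, mul_one, mul_zero, Finset.sum_ite_eq, Finset.mem_univ, if_true,
        Finset.sum_mul, Finset.mul_sum]
      exact Finset.sum_comm

theorem LUEquiv.entropy₂_eq {ρ σ : Op V} (h : LUEquiv ρ σ) (J : Finset V) :
    entropy₂ ρ J = entropy₂ σ J := by
  obtain ⟨U, rfl⟩ := h
  have hP := localOp_conjTranspose_mul_self fun v : {v // v ∈ J} => U v
  rw [entropy₂, entropy₂, reduced_localOp_conj]
  set P := localOp fun v : {v // v ∈ J} => (U v : Matrix (Fin 2) (Fin 2) ℂ)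
  have : (P * reduced ρ J * P.conjTranspose) ^ 2 =
      P * (reduced ρ J ^ 2 * P.conjTranspose) := by
    rw [pow_two, pow_two]
    calc _ = P * reduced ρ J * (P.conjTranspose * P) * reduced ρ J * P.conjTranspose := by
          simp only [Matrix.mul_assoc]
      _ = _ := by rw [hP]; simp only [Matrix.mul_assoc, Matrix.mul_one]
  rw [this, Matrix.trace_mul_comm, Matrix.mul_assoc, hP, Matrix.mul_one]

/-! ### The GHZ state -/

/-- Every reduced state of the GHZ state on a proper subset is the mixture
`(|0…0⟩⟨0…0| + |1…1⟩⟨1…1|) / 2`. -/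
theorem reduced_density_ghzKet (J : Finset V) (hJ : ∃ v, v ∉ J) :
    reduced (density (ghzKet V)) J = Matrix.diagonal fun a =>
      (1 / 2 : ℂ) * ((if a = fun _ => 0 then 1 else 0) + if a = fun _ => 1 then 1 else 0) := by
  obtain ⟨w, hw⟩ := hJ
  have h01 : (fun _ : {v // v ∉ J} => (0 : Fin 2)) ≠ fun _ => 1 := fun h => by
    simpa using congrFun h ⟨w, hw⟩
  have hghz : ∀ a c, ghzKet V (glue J a c) = ((1 / Real.sqrt 2 : ℝ) : ℂ) *
      ((if a = fun _ => 0 then 1 else 0) * (if c = fun _ => 0 then 1 else 0) +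
        (if a = fun _ => 1 then 1 else 0) * (if c = fun _ => 1 then 1 else 0)) := by
    intro a c
    simp only [ghzKet, basisKet, Pi.smul_apply, Pi.add_apply, Pi.single_apply,
      glue_eq_const_iff, smul_eq_mul, ite_and, ite_mul, one_mul, zero_mul]
  ext a b
  have hterm : ∀ c : {v // v ∉ J} → Fin 2,
      ghzKet V (glue J a c) * star (ghzKet V (glue J b c)) =
      (1 / 2 : ℂ) * ((if c = fun _ => 0 then
          (if a = fun _ => 0 then 1 else 0) * (if b = fun _ => 0 then 1 else 0) else 0) +
        (if c = fun _ => 1 then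
          (if a = fun _ => 1 then 1 else 0) * (if b = fun _ => 1 then 1 else 0) else 0)) := by
    intro c
    rw [hghz, hghz, ← invSqrtTwo_mul_self, star_mul', Complex.star_def, Complex.conj_ofReal]
    by_cases h0 : c = fun _ => 0
    · have h1 : c ≠ fun _ => 1 := h0 ▸ h01
      simp only [if_pos h0, if_neg h1]
      split_ifs <;> simp
    · by_cases h1 : c = fun _ => 1
      · simp only [if_neg h0, if_pos h1]
        split_ifs <;> simp
      · simp [h0, h1]
  simp only [reduced, density, Matrix.of_apply, Matrix.vecMulVec_apply, Pi.star_apply, hterm,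
    ← Finset.mul_sum, Finset.sum_add_distrib, Finset.sum_ite_eq', Finset.mem_univ, if_true,
    Matrix.diagonal_apply]
  by_cases hab : a = b
  · subst hab
    rw [if_pos rfl]
    split_ifs <;> simp
  · rw [if_neg hab]
    have h : ∀ d : {v // v ∈ J} → Fin 2,
        ((if a = d then 1 else 0) * (if b = d then 1 else 0) : ℂ) = 0 := by
      intro d
      by_cases ha : a = d
      · have hb : b ≠ d := fun hb => hab (ha.trans hb.symm)
        simp [hb]
      · simp [ha]
    rw [h, h]; simp

theorem entropy₂_ghzKet (J : Finset V) (hne : J.Nonempty) (hJ : ∃ v, v ∉ J) :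
    entropy₂ (density (ghzKet V)) J = 1 / 2 := by
  obtain ⟨u, hu⟩ := hne
  have h01 : (fun _ : {v // v ∈ J} => (0 : Fin 2)) ≠ fun _ => 1 := fun h => by
    simpa using congrFun h ⟨u, hu⟩
  have htr : Matrix.trace (reduced (density (ghzKet V)) J ^ 2) = 1 / 2 := by
    rw [reduced_density_ghzKet J hJ, pow_two, Matrix.diagonal_mul_diagonal,
      Matrix.trace_diagonal]
    have hterm : ∀ a : {v // v ∈ J} → Fin 2,
        ((1 / 2 : ℂ) * ((if a = fun _ => 0 then 1 else 0) + if a = fun _ => 1 then 1 else 0)) *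
          ((1 / 2 : ℂ) * ((if a = fun _ => 0 then 1 else 0) + if a = fun _ => 1 then 1 else 0)) =
        (if a = fun _ => 0 then 1 / 4 else 0) + if a = fun _ => 1 then 1 / 4 else 0 := by
      intro a
      by_cases h0 : a = fun _ => 0
      · have h1 : a ≠ fun _ => 1 := h0 ▸ h01
        simp only [if_pos h0, if_neg h1]; norm_num
      · simp only [if_neg h0]; split_ifs <;> norm_num
    simp only [hterm, Finset.sum_add_distrib, Finset.sum_ite_eq', Finset.mem_univ, if_true]
    norm_num
  rw [entropy₂, htr]
  norm_num

theorem localOp_mulVec_ghzKet (W : V → Matrix (Fin 2) (Fin 2) ℂ) (x : V → Fin 2) :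
    (localOp W).mulVec (ghzKet V) x =
      ((1 / Real.sqrt 2 : ℝ) : ℂ) * (∏ v, W v (x v) 0 + ∏ v, W v (x v) 1) := by
  rw [ghzKet, Matrix.mulVec_smul, Matrix.mulVec_add, basisKet, basisKet,
    Matrix.mulVec_single_one, Matrix.mulVec_single_one]
  rfl

/-! ### Star and complete graph states are GHZ states -/

theorem hadamard_apply_one (b : Fin 2) :
    hadamard b 1 = ((1 / Real.sqrt 2 : ℝ) : ℂ) * (bitSign b : ℂ) := by
  fin_cases b <;> simp [hadamard, bitSign]

theorem hadamard_mem_unitaryGroup : hadamard ∈ Matrix.unitaryGroup (Fin 2) ℂ := by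
  rw [Matrix.mem_unitaryGroup_iff, Matrix.star_eq_conjTranspose]
  have h := invSqrtTwo_mul_self
  unfold hadamard
  generalize (1 / Real.sqrt 2 : ℝ) = s at h ⊢
  ext i j
  fin_cases i <;> fin_cases j <;>
    simp [Matrix.mul_apply, Fin.sum_univ_two, Matrix.conjTranspose_apply] <;>
    linear_combination 2 * h

/-- `i ^ b` for a bit `b`. -/
def bitPhase (b : Fin 2) : ℂ := if b = 1 then Complex.I else 1

/-- The unitary with columns `|±i⟩ = (|0⟩ ± i|1⟩) / √2`, the eigenvectors of Pauli `Y`. -/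
noncomputable def eigenbasisY : Matrix (Fin 2) (Fin 2) ℂ :=
  ((1 / Real.sqrt 2 : ℝ) : ℂ) • !![1, 1; Complex.I, -Complex.I]

theorem eigenbasisY_apply_zero (b : Fin 2) :
    eigenbasisY b 0 = ((1 / Real.sqrt 2 : ℝ) : ℂ) * bitPhase b := by
  fin_cases b <;> simp [eigenbasisY, bitPhase]

theorem eigenbasisY_apply_one (b : Fin 2) :
    eigenbasisY b 1 = ((1 / Real.sqrt 2 : ℝ) : ℂ) * star (bitPhase b) := by
  fin_cases b <;> simp [eigenbasisY, bitPhase]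

theorem eigenbasisY_mem_unitaryGroup : eigenbasisY ∈ Matrix.unitaryGroup (Fin 2) ℂ := by
  rw [Matrix.mem_unitaryGroup_iff, Matrix.star_eq_conjTranspose]
  have h := invSqrtTwo_mul_self
  unfold eigenbasisY
  generalize (1 / Real.sqrt 2 : ℝ) = s at h ⊢
  ext i j
  fin_cases i <;> fin_cases j <;>
    simp [Matrix.mul_apply, Fin.sum_univ_two, Matrix.conjTranspose_apply] <;>
    (try ring_nf) <;> (try simp only [Complex.I_sq]) <;>
    linear_combination 2 * h

/-- `eigenbasisY` with its columns multiplied by `exp (-iπ/4)` and `exp (iπ/4)`. -/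
noncomputable def phasedEigenbasisY : Matrix (Fin 2) (Fin 2) ℂ :=
  !![(1 - Complex.I) / 2, (1 + Complex.I) / 2; (1 + Complex.I) / 2, (1 - Complex.I) / 2]

theorem phasedEigenbasisY_apply_zero (b : Fin 2) :
    phasedEigenbasisY b 0 = (1 - Complex.I) / 2 * bitPhase b := by
  fin_cases b <;> simp [phasedEigenbasisY, bitPhase]
  linear_combination (1 / 2 : ℂ) * Complex.I_mul_I

theorem phasedEigenbasisY_apply_one (b : Fin 2) :
    phasedEigenbasisY b 1 = (1 + Complex.I) / 2 * star (bitPhase b) := by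
  fin_cases b <;> simp [phasedEigenbasisY, bitPhase]
  linear_combination (1 / 2 : ℂ) * Complex.I_mul_I

theorem phasedEigenbasisY_mem_unitaryGroup :
    phasedEigenbasisY ∈ Matrix.unitaryGroup (Fin 2) ℂ := by
  rw [Matrix.mem_unitaryGroup_iff, Matrix.star_eq_conjTranspose]
  have h := Complex.I_mul_I
  have h2 : (starRingEnd ℂ) 2 = 2 := map_ofNat _ 2
  unfold phasedEigenbasisY
  ext i j
  fin_cases i <;> fin_cases j <;>
    simp [Matrix.mul_apply, Fin.sum_univ_two, Matrix.conjTranspose_apply, h2] <;>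
    first | linear_combination (-1 / 2 : ℂ) * h | linear_combination (1 / 2 : ℂ) * h

theorem invSqrtTwo_mul_pow_erase (r : V) :
    ((1 / Real.sqrt 2 : ℝ) : ℂ) * ((1 / Real.sqrt 2 : ℝ) : ℂ) ^ (Finset.univ.erase r).card =
      ((1 / Real.sqrt 2 : ℝ) : ℂ) ^ Fintype.card V := by
  rw [← pow_succ', Finset.card_erase_add_one (Finset.mem_univ r), Finset.card_univ]

variable (G : SimpleGraph V) [DecidableRel G.Adj]

theorem graphSign_of_eq_starGraph {r : V} (hG : G = SimpleGraph.starGraph r) (x : V → Fin 2) :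
    graphSign G x = if x r = 1 then ∏ v ∈ Finset.univ.erase r, bitSign (x v) else 1 := by
  have hadj : ∀ a b, G.Adj a b ↔ a ≠ b ∧ (a = r ∨ b = r) := by
    intro a b; rw [hG, SimpleGraph.starGraph_adj]
  have hnb : G.neighborFinset r = Finset.univ.erase r := by
    ext v; simp [hadj, eq_comm]
  rw [graphSign_eq_mul G r, hnb, Finset.prod_eq_one, one_mul]
  intro e he
  exfalso
  induction e using Sym2.ind with
  | _ a b =>
    simp [hadj] at he
    grind

/-- The graph state of a star is a GHZ state with the Hadamard gate applied at every leaf. -/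
theorem luEquiv_of_eq_starGraph {r : V} (hG : G = SimpleGraph.starGraph r) :
    LUEquiv (density (graphKet G)) (density (ghzKet V)) := by
  let W : V → Matrix.unitaryGroup (Fin 2) ℂ := fun v =>
    if v = r then 1 else ⟨hadamard, hadamard_mem_unitaryGroup⟩
  have hr : (W r : Matrix (Fin 2) (Fin 2) ℂ) = 1 := by simp [W]
  have hv : ∀ v ∈ Finset.univ.erase r, (W v : Matrix (Fin 2) (Fin 2) ℂ) = hadamard := by
    intro v h
    simp [W, Finset.ne_of_mem_erase h]
  have hψ : (localOp fun v => (W v : Matrix (Fin 2) (Fin 2) ℂ)).mulVec (ghzKet V) =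
      graphKet G := by
    ext x
    have hv0 : ∏ v ∈ Finset.univ.erase r, (W v : Matrix (Fin 2) (Fin 2) ℂ) (x v) 0 =
        ∏ v ∈ Finset.univ.erase r, ((1 / Real.sqrt 2 : ℝ) : ℂ) :=
      Finset.prod_congr rfl fun v h => by rw [hv v h, hadamard_apply_zero]
    have hv1 : ∏ v ∈ Finset.univ.erase r, (W v : Matrix (Fin 2) (Fin 2) ℂ) (x v) 1 =
        ∏ v ∈ Finset.univ.erase r, (((1 / Real.sqrt 2 : ℝ) : ℂ) * (bitSign (x v) : ℂ)) :=
      Finset.prod_congr rfl fun v h => by rw [hv v h, hadamard_apply_one]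
    rw [localOp_mulVec_ghzKet, graphKet_apply, graphSign_of_eq_starGraph G hG,
      ← Finset.mul_prod_erase _ _ (Finset.mem_univ r),
      ← Finset.mul_prod_erase _ (fun v => (W v : Matrix (Fin 2) (Fin 2) ℂ) (x v) 1)
        (Finset.mem_univ r), hr,
      hv0, hv1,
      Finset.prod_mul_distrib, Finset.prod_const, ← invSqrtTwo_mul_pow_erase r]
    obtain h | h : x r = 0 ∨ x r = 1 := by
      generalize x r = b; fin_cases b <;> simp
    · simp [h, Matrix.one_apply]
    · simp [h, Matrix.one_apply, mul_assoc]
  rw [← hψ]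
  exact luEquiv_density_mulVec W _

/-- `(-1)^(k(k-1)/2)` is the combination of `i^k` and `(-i)^k` with coefficients `(1 ∓ i)/2`. -/
theorem graphSign_of_eq_top (hG : G = ⊤) (x : V → Fin 2) :
    (graphSign G x : ℂ) = (1 - Complex.I) / 2 * ∏ v, bitPhase (x v) +
      (1 + Complex.I) / 2 * ∏ v, star (bitPhase (x v)) := by
  refine (eq_graphSign G (fun x => (1 - Complex.I) / 2 * ∏ v, bitPhase (x v) +
      (1 + Complex.I) / 2 * ∏ v, star (bitPhase (x v))) ?_ (fun w x hx => ?_) x).symm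
  · simp [bitPhase]; ring
  · have hnb : G.neighborFinset w = Finset.univ.erase w := by
      ext v; simp [hG, eq_comm]
    have hsplit : ∀ (F : Fin 2 → ℂ) (b : Fin 2), ∏ v, F (Function.update x w b v) =
        F b * ∏ v ∈ Finset.univ.erase w, F (x v) := by
      intro F b
      rw [← Finset.mul_prod_erase _ _ (Finset.mem_univ w), Function.update_self]
      congr 1
      exact Finset.prod_congr rfl fun v hv => by
        rw [Function.update_of_ne (Finset.ne_of_mem_erase hv)]
    have hx0 : Function.update x w 0 = x := by rw [← hx]; exact Function.update_eq_self w x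
    have h0 : ∀ F : Fin 2 → ℂ, ∏ v, F (x v) = F 0 * ∏ v ∈ Finset.univ.erase w, F (x v) := by
      intro F
      rw [← hsplit F 0, hx0]
    have hs1 : ∀ b, bitPhase b * (bitSign b : ℂ) = star (bitPhase b) := by
      intro b; fin_cases b <;> simp [bitPhase, bitSign]
    have hs2 : ∀ b, star (bitPhase b) * (bitSign b : ℂ) = bitPhase b := by
      intro b; fin_cases b <;> simp [bitPhase, bitSign]
    have hp1 : (∏ v ∈ Finset.univ.erase w, bitPhase (x v)) *
        ∏ v ∈ Finset.univ.erase w, (bitSign (x v) : ℂ) =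
        ∏ v ∈ Finset.univ.erase w, star (bitPhase (x v)) := by
      rw [← Finset.prod_mul_distrib]; simp only [hs1]
    have hp2 : (∏ v ∈ Finset.univ.erase w, star (bitPhase (x v))) *
        ∏ v ∈ Finset.univ.erase w, (bitSign (x v) : ℂ) =
        ∏ v ∈ Finset.univ.erase w, bitPhase (x v) := by
      rw [← Finset.prod_mul_distrib]; simp only [hs2]
    have hI : bitPhase 1 = Complex.I := by simp [bitPhase]
    have h1 : bitPhase 0 = 1 := by simp [bitPhase]
    rw [hsplit bitPhase, hsplit fun b => star (bitPhase b), h0 bitPhase,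
      h0 fun b => star (bitPhase b), hnb, hI, h1, star_one, Complex.star_def, Complex.conj_I]
    simp only [Complex.star_def] at hp1 hp2 ⊢
    push_cast
    generalize (∏ v ∈ Finset.univ.erase w, (bitSign (x v) : ℂ)) = S at *
    generalize (∏ v ∈ Finset.univ.erase w, bitPhase (x v)) = P at *
    generalize (∏ v ∈ Finset.univ.erase w, (starRingEnd ℂ) (bitPhase (x v))) = Q at *
    linear_combination (-(P + Q) / 2) * Complex.I_mul_I - (1 - Complex.I) / 2 * hp1 -
      (1 + Complex.I) / 2 * hp2

/-- The graph state of a complete graph is a GHZ state in the eigenbasis of Pauli `Y`, up to a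
relative phase, which is absorbed at one vertex. -/
theorem luEquiv_of_eq_top [Nonempty V] (hG : G = ⊤) :
    LUEquiv (density (graphKet G)) (density (ghzKet V)) := by
  obtain ⟨r⟩ := ‹Nonempty V›
  let W : V → Matrix.unitaryGroup (Fin 2) ℂ := fun v =>
    if v = r then ⟨phasedEigenbasisY, phasedEigenbasisY_mem_unitaryGroup⟩
    else ⟨eigenbasisY, eigenbasisY_mem_unitaryGroup⟩
  have hr : (W r : Matrix (Fin 2) (Fin 2) ℂ) = phasedEigenbasisY := by simp [W]
  have hv : ∀ v ∈ Finset.univ.erase r, (W v : Matrix (Fin 2) (Fin 2) ℂ) = eigenbasisY := by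
    intro v h
    simp [W, Finset.ne_of_mem_erase h]
  have hψ : (localOp fun v => (W v : Matrix (Fin 2) (Fin 2) ℂ)).mulVec (ghzKet V) =
      graphKet G := by
    ext x
    have hv0 : ∏ v ∈ Finset.univ.erase r, (W v : Matrix (Fin 2) (Fin 2) ℂ) (x v) 0 =
        ∏ v ∈ Finset.univ.erase r, (((1 / Real.sqrt 2 : ℝ) : ℂ) * bitPhase (x v)) :=
      Finset.prod_congr rfl fun v h => by rw [hv v h, eigenbasisY_apply_zero]
    have hv1 : ∏ v ∈ Finset.univ.erase r, (W v : Matrix (Fin 2) (Fin 2) ℂ) (x v) 1 =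
        ∏ v ∈ Finset.univ.erase r, (((1 / Real.sqrt 2 : ℝ) : ℂ) * star (bitPhase (x v))) :=
      Finset.prod_congr rfl fun v h => by rw [hv v h, eigenbasisY_apply_one]
    rw [localOp_mulVec_ghzKet, graphKet_apply, graphSign_of_eq_top G hG,
      ← Finset.mul_prod_erase _ _ (Finset.mem_univ r),
      ← Finset.mul_prod_erase _ (fun v => (W v : Matrix (Fin 2) (Fin 2) ℂ) (x v) 1)
        (Finset.mem_univ r), hr,
      hv0, hv1,
      Finset.prod_mul_distrib, Finset.prod_mul_distrib, Finset.prod_const,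
      ← invSqrtTwo_mul_pow_erase r, phasedEigenbasisY_apply_zero, phasedEigenbasisY_apply_one,
      ← Finset.mul_prod_erase _ (fun v => bitPhase (x v)) (Finset.mem_univ r),
      ← Finset.mul_prod_erase _ (fun v => star (bitPhase (x v))) (Finset.mem_univ r)]
    ring
  rw [← hψ]
  exact luEquiv_density_mulVec W _

end
end QubitState

theorem mainTheorem3 {V : Type*} [Fintype V] [DecidableEq V] (hV : 3 ≤ Fintype.card V)
    (G : SimpleGraph V) [DecidableRel G.Adj] (hG : G.Connected) :
    (QubitState.LUEquiv (QubitState.density (QubitState.graphKet G))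
        (QubitState.density (QubitState.ghzKet V)) ↔
      ∀ u v : V, u ≠ v →
        QubitState.corr₂ (QubitState.density (QubitState.graphKet G)) {u} {v} = 1 / 2) ∧
    ((∀ u v : V, u ≠ v →
        QubitState.corr₂ (QubitState.density (QubitState.graphKet G)) {u} {v} = 1 / 2) →
      (∃ r : V, G = SimpleGraph.starGraph r) ∨ G = ⊤) := by
  have : Nontrivial V := Fintype.one_lt_card_iff_nontrivial.1 (by omega)
  refine ⟨⟨fun h u v huv => ?_, fun h => ?_⟩, QubitState.starGraph_or_top_of_corr₂ G hG⟩
  · -- A pair of vertices is a proper subset because there are at least three vertices.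
    have hproper : ∃ w, w ∉ ({u, v} : Finset V) := by
      by_contra! hc
      have h1 : (Finset.univ : Finset V) ⊆ {u, v} := fun w _ => hc w
      have h2 := (Finset.card_le_card h1).trans Finset.card_le_two
      rw [Finset.card_univ] at h2
      omega
    rw [QubitState.corr₂, ← Finset.insert_eq, h.entropy₂_eq, h.entropy₂_eq, h.entropy₂_eq,
      QubitState.entropy₂_ghzKet _ (by simp) ⟨v, by simpa using huv.symm⟩,
      QubitState.entropy₂_ghzKet _ (by simp) ⟨u, by simpa using huv⟩,
      QubitState.entropy₂_ghzKet _ (by simp) hproper]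
    norm_num
  · rcases QubitState.starGraph_or_top_of_corr₂ G hG h with ⟨r, hr⟩ | htop
    · exact QubitState.luEquiv_of_eq_starGraph G hr
    · exact QubitState.luEquiv_of_eq_top G htop
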